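/- Let $(X,d,\mu)$ be a complete metric space equipped with a doubling Borel regular outer measure $\mu$ (there is $C_d\ge 1$ with $0<\mu(B(x,2r))\le C_d\,\mu(B(x,r))<\infty$ for all $x\in X$, $r>0$) that supports a $(1,1)$-Poincaré inequality: there are $C_P,\lambda\ge 1$ such that for every ball $B=B(x,r)$, every locally integrable function $u$ on $X$ and every upper gradient $g$ of $u$, $$\frac1{\mu(B)}\int_{B}|u-u_B|\,d\mu\le C_P\,r\,\frac{1}{\mu(B(x,\lambda r))}\int_{B(x,\lambda r)}g\,d\mu,\qquad u_B=\frac1{\mu(B)}\int_B u\,d\mu .$$ A curve is a nonconstant rectifiable continuous map from a compact interval into $X$; curve integrals are taken with respect to arc length. A nonnegative Borel function $g$ is an upper gradient of $u$ if $|u(x)-u(y)|\le\int_\gamma g\,ds$ for every curve $\gamma$ with end points $x,y$. A nonnegative $\mu$-measurable function $g$ on an open set $\Omega$ is a $1$-weak upper gradient of $u$ in $\Omega$ if this holds for all curves $\gamma$ in $\Omega$ outside a family $\Gamma$ for which there is a nonnegative Borel function $\rho\in L^1(X)$ with $\int_\gamma\rho\,ds=\infty$ for all $\gamma\in\Gamma$.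 The minimal $1$-weak upper gradient $g_u$ of $u$ in $\Omega$ is the $1$-weak upper gradient in $L^1_{\mathrm{loc}}(\Omega)$ that is a.e. at most any other one in $L^1_{\mathrm{loc}}(\Omega)$. "Locally" in $\Omega$ means: on every open set whose closure is a compact subset of $\Omega$. The total variation of $u\in L^1_{\mathrm{loc}}(\Omega)$ is $$\|Du\|(\Omega)=\inf\Big\{\liminf_{i\to\infty}\int_\Omega g_{u_i}\,d\mu:\ u_i\in\mathrm{Lip}_{\mathrm{loc}}(\Omega),\ u_i\to u\text{ in }L^1_{\mathrm{loc}}(\Omega)\Big\},$$ and $\mathrm{BV}(X)$ is the set of ($\mu$-equivalence classes of) $u\in L^1(X)$ with $\|Du\|(X)<\infty$. For a function $u$ on $X$ let $$u^\wedge(x)=\sup\Big\{t\in\mathbb R:\lim_{r\to0}\tfrac{\mu(\{u<t\}\cap B(x,r))}{\mu(B(x,r))}=0\Big\},\qquad u^\vee(x)=\inf\Big\{t\in\mathbb R:\lim_{r\to0}\tfrac{\mu(\{u>t\}\cap B(x,r))}{\mu(B(x,r))}=0\Big\}.$$ Let $\mathcal H(A)=\lim_{R\to0}\mathcal H_R(A)$,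 where $\mathcal H_R(A)=\inf\sum_i\mu(B(x_i,r_i))/r_i$ over all countable (finite or infinite) covers of $A$ by balls $B(x_i,r_i)$ with $0<r_i\le R$. For $D\subset X$ let $\mathrm{BV}_0(D)$ be the set of $u\in\mathrm{BV}(X)$ with $u^\wedge=u^\vee=0$ at $\mathcal H$-a.e. point of $X\setminus D$, and for $A\subset D\subset X$ let $$\mathrm{rcap}_{\mathrm{BV}}(A,D)=\inf\{\|Du\|(X):\ u\in\mathrm{BV}_0(D),\ u^\wedge\ge1\ \ \mathcal H\text{-a.e. on }A\}\in[0,\infty].$$ Then the following hold. 1. For every $D\subset X$, $\mathrm{rcap}_{\mathrm{BV}}(\emptyset,D)=0$. 2. If $A_1\subset A_2\subset D\subset X$, then $\mathrm{rcap}_{\mathrm{BV}}(A_1,D)\le\mathrm{rcap}_{\mathrm{BV}}(A_2,D)$. 3. If $A\subset D_1\subset D_2\subset X$, then $\mathrm{rcap}_{\mathrm{BV}}(A,D_2)\le\mathrm{rcap}_{\mathrm{BV}}(A,D_1)$. 4. If $A_1,A_2\subset D\subset X$, then $$\mathrm{rcap}_{\mathrm{BV}}(A_1\cap A_2,D)+\mathrm{rcap}_{\mathrm{BV}}(A_1\cup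 A_2,D)\le\mathrm{rcap}_{\mathrm{BV}}(A_1,D)+\mathrm{rcap}_{\mathrm{BV}}(A_2,D).$$ -/

import Mathlib

open MeasureTheory Filter Set
open scoped ENNReal NNReal Topology

noncomputable section

namespace MetricBV

/-- A curve: a nonconstant, rectifiable, continuous map from a compact interval `[a, b]` to `X`.
Values of `toFun` outside `[a, b]` are irrelevant. -/
structure Curve (X : Type*) [MetricSpace X] where
  a : ℝ
  b : ℝ
  le : a ≤ b
  toFun : ℝ → X
  continuousOn : ContinuousOn toFun (Icc a b)
  rectifiable : eVariationOn toFun (Icc a b) ≠ ∞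
  nonconstant : ∃ s ∈ Icc a b, ∃ t ∈ Icc a b, toFun s ≠ toFun t

namespace Curve

variable {X : Type*} [MetricSpace X]

/-- The trace (image) of a curve. -/
def trace (γ : Curve X) : Set X := γ.toFun '' Icc γ.a γ.b

/-- The length of a curve. -/
def length (γ : Curve X) : ℝ := (eVariationOn γ.toFun (Icc γ.a γ.b)).toReal

/-- The arc-length parametrization of a curve, relevant on `[0, length]`. -/
def arcLength (γ : Curve X) : ℝ → X := naturalParameterization γ.toFun (Icc γ.a γ.b) γ.a

/-- The curve integral `∫_γ g ds` of a nonnegative function. -/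
def integral (γ : Curve X) (g : X → ℝ≥0∞) : ℝ≥0∞ :=
  ∫⁻ t in Icc 0 γ.length, g (γ.arcLength t)

/-- The upper gradient inequality for the pair `(u, g)` on the curve `γ`. -/
def UpperGradientIneq (γ : Curve X) (u : X → ℝ) (g : X → ℝ≥0∞) : Prop :=
  ENNReal.ofReal |u (γ.toFun γ.a) - u (γ.toFun γ.b)| ≤ γ.integral g

end Curve

variable {X : Type*} [MetricSpace X] [MeasurableSpace X]

/-- `μ` is doubling. -/
def IsDoubling (μ : Measure X) : Prop :=
  ∃ C : ℝ, 1 ≤ C ∧ ∀ (x : X) (r : ℝ), 0 < r →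
    0 < μ (Metric.ball x (2 * r)) ∧
    μ (Metric.ball x (2 * r)) ≤ ENNReal.ofReal C * μ (Metric.ball x r) ∧
    μ (Metric.ball x r) < ∞

/-- The nonnegative Borel function `g` is an upper gradient of `u` in `X`. -/
def IsUpperGradient (u : X → ℝ) (g : X → ℝ≥0∞) : Prop :=
  Measurable g ∧ ∀ γ : Curve X, γ.UpperGradientIneq u g

/-- `(X, d, μ)` supports a `(1,1)`-Poincaré inequality. -/
def SupportsPoincare (μ : Measure X) : Prop :=
  ∃ C l : ℝ, 1 ≤ C ∧ 1 ≤ l ∧ ∀ (x : X) (r : ℝ), 0 < r →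
    ∀ (u : X → ℝ) (g : X → ℝ≥0∞), LocallyIntegrable u μ → IsUpperGradient u g →
      (⨍⁻ y in Metric.ball x r,
          ENNReal.ofReal |u y - ⨍ z in Metric.ball x r, u z ∂μ| ∂μ) ≤
        ENNReal.ofReal (C * r) * ⨍⁻ y in Metric.ball x (l * r), g y ∂μ

/-- The curve family `Γ` has zero `1`-modulus. -/
def ZeroModulus (μ : Measure X) (Γ : Set (Curve X)) : Prop :=
  ∃ ρ : X → ℝ≥0∞, Measurable ρ ∧ ∫⁻ x, ρ x ∂μ ≠ ∞ ∧ ∀ γ ∈ Γ, γ.integral ρ = ∞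

/-- `g` is a `1`-weak upper gradient of `u` in `Ω`: it is nonnegative and `μ`-measurable on `Ω`,
and the upper gradient inequality holds for `1`-almost every curve in `Ω`. -/
def IsWeakUpperGradient (μ : Measure X) (Ω : Set X) (u : X → ℝ) (g : X → ℝ≥0∞) : Prop :=
  AEMeasurable g (μ.restrict Ω) ∧
    ZeroModulus μ {γ : Curve X | γ.trace ⊆ Ω ∧ ¬ γ.UpperGradientIneq u g}

/-- `Ω'` is open and its closure is a compact subset of `Ω`. -/
def CompactlyInside (Ω' Ω : Set X) : Prop :=
  IsOpen Ω' ∧ IsCompact (closure Ω') ∧ closure Ω' ⊆ Ω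

/-- A nonnegative function belongs to `L¹_loc(Ω)` (measurability aside). -/
def LocallyFinite (μ : Measure X) (Ω : Set X) (g : X → ℝ≥0∞) : Prop :=
  ∀ Ω' : Set X, CompactlyInside Ω' Ω → ∫⁻ x in Ω', g x ∂μ ≠ ∞

/-- `g` is the (a.e. unique) minimal `1`-weak upper gradient of `u` in `Ω`. -/
def IsMinimalWeakUpperGradient (μ : Measure X) (Ω : Set X) (u : X → ℝ) (g : X → ℝ≥0∞) : Prop :=
  IsWeakUpperGradient μ Ω u g ∧ LocallyFinite μ Ω g ∧
    ∀ h : X → ℝ≥0∞, IsWeakUpperGradient μ Ω u h → LocallyFinite μ Ω h →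
      ∀ᵐ x ∂(μ.restrict Ω), g x ≤ h x

/-- `u ∈ Lip_loc(Ω)`. -/
def LipLoc (Ω : Set X) (u : X → ℝ) : Prop :=
  ∀ Ω' : Set X, CompactlyInside Ω' Ω → ∃ K : ℝ≥0, LipschitzOnWith K u Ω'

/-- `v i → u` in `L¹_loc(Ω)`. -/
def TendstoL1Loc (μ : Measure X) (Ω : Set X) (v : ℕ → X → ℝ) (u : X → ℝ) : Prop :=
  ∀ Ω' : Set X, CompactlyInside Ω' Ω →
    Tendsto (fun i => ∫⁻ x in Ω', ENNReal.ofReal |v i x - u x| ∂μ) atTop (𝓝 0)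

/-- The total variation `‖Du‖(Ω)` of `u ∈ L¹_loc(Ω)` in an open set `Ω`: the infimum of
`liminf ∫_Ω g_{v i} dμ` over sequences of locally Lipschitz functions `v i → u` in `L¹_loc(Ω)`,
where `g i = g_{v i}` is the minimal `1`-weak upper gradient of `v i` in `Ω`. -/
def totalVariation (μ : Measure X) (Ω : Set X) (u : X → ℝ) : ℝ≥0∞ :=
  ⨅ (v : ℕ → X → ℝ) (g : ℕ → X → ℝ≥0∞) (_ : ∀ i, LipLoc Ω (v i))
    (_ : ∀ i, IsMinimalWeakUpperGradient μ Ω (v i) (g i)) (_ : TendstoL1Loc μ Ω v u),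
    liminf (fun i => ∫⁻ x in Ω, g i x ∂μ) atTop

/-- `u ∈ BV(X)`. Elements of `BV(X)` are `μ`-equivalence classes; `u` is any real-valued
representative, and all notions below depend only on its class. -/
def MemBV (μ : Measure X) (u : X → ℝ) : Prop :=
  Integrable u μ ∧ totalVariation μ univ u < ∞

/-- The lower approximate limit `u^∧`. -/
def approxLower (μ : Measure X) (u : X → ℝ) (x : X) : EReal :=
  ⨆ (t : ℝ) (_ : Tendsto (fun r : ℝ => μ ({y | u y < t} ∩ Metric.ball x r) / μ (Metric.ball x r))
    (𝓝[>] 0) (𝓝 0)), (t : EReal)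

/-- The upper approximate limit `u^∨`. -/
def approxUpper (μ : Measure X) (u : X → ℝ) (x : X) : EReal :=
  ⨅ (t : ℝ) (_ : Tendsto (fun r : ℝ => μ ({y | t < u y} ∩ Metric.ball x r) / μ (Metric.ball x r))
    (𝓝[>] 0) (𝓝 0)), (t : EReal)

/-- The restricted spherical Hausdorff content of codimension one: the infimum over (finite or
infinite) countable covers by balls `B(x, r)`, coded as pairs `(x, r)` with `0 < r ≤ R`. -/
def hausdorffContent (μ : Measure X) (R : ℝ) (A : Set X) : ℝ≥0∞ :=
  ⨅ (S : Set (X × ℝ)) (_ : S.Countable) (_ : ∀ p ∈ S, 0 < p.2 ∧ p.2 ≤ R)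
    (_ : A ⊆ ⋃ p ∈ S, Metric.ball p.1 p.2),
    ∑' p : S, μ (Metric.ball p.1.1 p.1.2) / ENNReal.ofReal p.1.2

/-- The codimension one Hausdorff measure: the limit of the contents as `R → 0`, which is their
supremum, since the content is nonincreasing in `R`. -/
def codimOneHausdorff (μ : Measure X) (A : Set X) : ℝ≥0∞ :=
  ⨆ (R : ℝ) (_ : 0 < R), hausdorffContent μ R A

/-- `u ∈ BV₀(D)`, where functions in `BV₀(D)` are understood as functions on all of `X`:
`u ∈ BV(X)` and `u^∧ = u^∨ = 0` at `𝓗`-a.e. point of `X \ D`. -/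
def MemBVZero (μ : Measure X) (D : Set X) (u : X → ℝ) : Prop :=
  MemBV μ u ∧
    codimOneHausdorff μ {x | x ∉ D ∧ ¬ (approxLower μ u x = 0 ∧ approxUpper μ u x = 0)} = 0

/-- The variational `BV`-capacity of `A` with respect to `D`: the infimum of `‖Du‖(X)` over all
`u ∈ BV₀(D)` such that `u^∧ ≥ 1` at `𝓗`-a.e. point of `A`. -/
def rcapBV (μ : Measure X) (A D : Set X) : ℝ≥0∞ :=
  ⨅ (u : X → ℝ) (_ : MemBVZero μ D u)
    (_ : codimOneHausdorff μ {x | x ∈ A ∧ ¬ 1 ≤ approxLower μ u x} = 0),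
    totalVariation μ univ u

end MetricBV

end

namespace MetricBV

namespace Curve

variable {X : Type*} [MetricSpace X]

lemma locallyBoundedVariationOn (γ : Curve X) :
    LocallyBoundedVariationOn γ.toFun (Icc γ.a γ.b) :=
  BoundedVariationOn.locallyBoundedVariationOn γ.rectifiable

lemma variationOnFromTo_left_right (γ : Curve X) :
    variationOnFromTo γ.toFun (Icc γ.a γ.b) γ.a γ.b = γ.length := by
  rw [variationOnFromTo.eq_of_le _ _ γ.le, inter_self, length]

lemma continuousOn_variationOnFromTo (γ : Curve X) :
    ContinuousOn (variationOnFromTo γ.toFun (Icc γ.a γ.b) γ.a) (Icc γ.a γ.b) := by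
  intro x hx
  have hl := variationOnFromTo.tendsto_left (left_mem_Icc.2 γ.le) hx γ.locallyBoundedVariationOn
    ((γ.continuousOn x hx).mono_left (nhdsWithin_mono _ inter_subset_left))
  have hr := variationOnFromTo.tendsto_right (left_mem_Icc.2 γ.le) hx γ.locallyBoundedVariationOn
    ((γ.continuousOn x hx).mono_left (nhdsWithin_mono _ inter_subset_left))
  rw [dist_self, sub_zero] at hl
  rw [dist_self, add_zero] at hr
  have h : Icc γ.a γ.b ⊆ insert x (Icc γ.a γ.b ∩ Iio x ∪ Icc γ.a γ.b ∩ Ioi x) := by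
    intro y hy
    rcases lt_trichotomy y x with h | h | h
    · exact Or.inr (Or.inl ⟨hy, h⟩)
    · exact Or.inl h
    · exact Or.inr (Or.inr ⟨hy, h⟩)
  refine ContinuousWithinAt.mono ?_ h
  rw [continuousWithinAt_insert_self]
  exact ContinuousWithinAt.union hl hr

lemma image_variationOnFromTo (γ : Curve X) :
    variationOnFromTo γ.toFun (Icc γ.a γ.b) γ.a '' Icc γ.a γ.b = Icc 0 γ.length := by
  have hm := variationOnFromTo.monotoneOn γ.locallyBoundedVariationOn (left_mem_Icc.2 γ.le)
  apply Subset.antisymm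
  · rintro _ ⟨x, hx, rfl⟩
    refine ⟨variationOnFromTo.nonneg_of_le _ _ hx.1, ?_⟩
    rw [← γ.variationOnFromTo_left_right]
    exact hm hx (right_mem_Icc.2 γ.le) hx.2
  · have := intermediate_value_Icc γ.le γ.continuousOn_variationOnFromTo
    rwa [variationOnFromTo.self, γ.variationOnFromTo_left_right] at this

lemma length_nonneg (γ : Curve X) : 0 ≤ γ.length := ENNReal.toReal_nonneg

lemma hasUnitSpeedOn_arcLength (γ : Curve X) : HasUnitSpeedOn γ.arcLength (Icc 0 γ.length) := by
  have := has_unit_speed_naturalParameterization γ.toFun γ.locallyBoundedVariationOn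
    (left_mem_Icc.2 γ.le)
  rwa [γ.image_variationOnFromTo] at this

lemma arcLength_variationOnFromTo (γ : Curve X) {t : ℝ} (ht : t ∈ Icc γ.a γ.b) :
    γ.arcLength (variationOnFromTo γ.toFun (Icc γ.a γ.b) γ.a t) = γ.toFun t :=
  edist_eq_zero.1 (edist_naturalParameterization_eq_zero γ.locallyBoundedVariationOn
    (left_mem_Icc.2 γ.le) ht)

lemma arcLength_zero (γ : Curve X) : γ.arcLength 0 = γ.toFun γ.a := by
  have := γ.arcLength_variationOnFromTo (left_mem_Icc.2 γ.le)
  rwa [variationOnFromTo.self] at this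

lemma arcLength_length (γ : Curve X) : γ.arcLength γ.length = γ.toFun γ.b := by
  have := γ.arcLength_variationOnFromTo (right_mem_Icc.2 γ.le)
  rwa [γ.variationOnFromTo_left_right] at this

end Curve

lemma _root_.HasUnitSpeedOn.lipschitzOnWith {X : Type*} [PseudoEMetricSpace X] {c : ℝ → X}
    {s : Set ℝ} (h : HasUnitSpeedOn c s) : LipschitzOnWith 1 c s := by
  intro x hx y hy
  wlog hxy : x ≤ y generalizing x y
  · rw [edist_comm, edist_comm x]
    exact this hy hx (le_of_not_ge hxy)
  have h1 := eVariationOn.edist_le c (s := s ∩ Icc x y) ⟨hx, le_rfl, hxy⟩ ⟨hy, hxy, le_rfl⟩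
  rw [h hx hy] at h1
  refine h1.trans_eq ?_
  rw [edist_comm, edist_dist, Real.dist_eq, abs_of_nonneg (sub_nonneg.2 hxy)]
  simp

namespace Curve

variable {X : Type*} [MetricSpace X]

/-- A nondegenerate arc of a unit speed curve. -/
def ofUnitSpeed (c : ℝ → X) {s t : ℝ} (hst : s < t) (hc : HasUnitSpeedOn c (Icc s t)) :
    Curve X where
  a := s
  b := t
  le := hst.le
  toFun := c
  continuousOn := hc.lipschitzOnWith.continuousOn
  rectifiable := by
    have := hc (left_mem_Icc.2 hst.le) (right_mem_Icc.2 hst.le)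
    rw [inter_self] at this
    rw [this]
    exact ENNReal.ofReal_ne_top
  nonconstant := by
    by_contra! h
    have h1 := hc (left_mem_Icc.2 hst.le) (right_mem_Icc.2 hst.le)
    rw [inter_self, eVariationOn.constant_on] at h1
    · have := ENNReal.ofReal_eq_zero.1 h1.symm
      simp only [NNReal.coe_one, one_mul, sub_nonpos] at this
      exact absurd hst (not_lt.2 this)
    · rintro _ ⟨x, hx, rfl⟩ _ ⟨y, hy, rfl⟩
      exact h x hx y hy

lemma length_ofUnitSpeed (c : ℝ → X) {s t : ℝ} (hst : s < t) (hc : HasUnitSpeedOn c (Icc s t)) :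
    (ofUnitSpeed c hst hc).length = t - s := by
  have := hc (left_mem_Icc.2 hst.le) (right_mem_Icc.2 hst.le)
  rw [inter_self] at this
  simp only [length, ofUnitSpeed, this, NNReal.coe_one, one_mul]
  exact ENNReal.toReal_ofReal (sub_nonneg.2 hst.le)

lemma integral_ofUnitSpeed (c : ℝ → X) {s t : ℝ} (hst : s < t)
    (hc : HasUnitSpeedOn c (Icc s t)) (g : X → ℝ≥0∞) :
    (ofUnitSpeed c hst hc).integral g = ∫⁻ x in Icc s t, g (c x) := by
  rw [integral, length_ofUnitSpeed]
  have harc : ∀ x ∈ Icc 0 (t - s), (ofUnitSpeed c hst hc).arcLength x = c (s + x) := by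
    intro x hx
    have hsx : s + x ∈ Icc s t := ⟨by linarith [hx.1], by linarith [hx.2]⟩
    have h1 := (ofUnitSpeed c hst hc).arcLength_variationOnFromTo hsx
    have h2 := (hasConstantSpeedOnWith_iff_variationOnFromTo_eq.1 hc).2
      (left_mem_Icc.2 hst.le) hsx
    simp only [NNReal.coe_one, one_mul, add_sub_cancel_left] at h2
    change (ofUnitSpeed c hst hc).arcLength (variationOnFromTo c (Icc s t) s (s + x)) = c (s + x)
      at h1
    rwa [h2] at h1
  rw [setLIntegral_congr_fun measurableSet_Icc (fun x hx => by rw [harc x hx])]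
  have h := (measurePreserving_add_left volume s).setLIntegral_comp_preimage_emb
    (MeasurableEquiv.addLeft s).measurableEmbedding (fun x => g (c x)) (Icc s t)
  rw [← h]
  simp

lemma lipschitzOnWith_arcLength (γ : Curve X) :
    LipschitzOnWith 1 γ.arcLength (Icc 0 γ.length) :=
  γ.hasUnitSpeedOn_arcLength.lipschitzOnWith

lemma hasUnitSpeedOn_arcLength_Icc (γ : Curve X) {s t : ℝ} (hs : 0 ≤ s) (ht : t ≤ γ.length) :
    HasUnitSpeedOn γ.arcLength (Icc s t) := by
  intro x hx y hy
  have hsub := Icc_subset_Icc hs ht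
  rw [← γ.hasUnitSpeedOn_arcLength (hsub hx) (hsub hy)]
  congr 1
  have h1 : Icc x y ⊆ Icc s t := Icc_subset_Icc hx.1 hy.2
  rw [inter_eq_right.2 h1, inter_eq_right.2 (h1.trans hsub)]

/-- The arc of a curve between the arc length parameters `s < t`. -/
noncomputable def arc (γ : Curve X) {s t : ℝ} (hs : 0 ≤ s) (hst : s < t) (ht : t ≤ γ.length) : Curve X :=
  ofUnitSpeed γ.arcLength hst (γ.hasUnitSpeedOn_arcLength_Icc hs ht)

lemma integral_arc (γ : Curve X) {s t : ℝ} (hs : 0 ≤ s) (hst : s < t) (ht : t ≤ γ.length)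
    (g : X → ℝ≥0∞) : (γ.arc hs hst ht).integral g = ∫⁻ x in Icc s t, g (γ.arcLength x) :=
  integral_ofUnitSpeed _ _ _ _

lemma integral_arc_le (γ : Curve X) {s t : ℝ} (hs : 0 ≤ s) (hst : s < t) (ht : t ≤ γ.length)
    (g : X → ℝ≥0∞) : (γ.arc hs hst ht).integral g ≤ γ.integral g := by
  rw [integral_arc]
  exact lintegral_mono_set (Icc_subset_Icc hs ht)

lemma upperGradientIneq_arc_iff (γ : Curve X) {s t : ℝ} (hs : 0 ≤ s) (hst : s < t)
    (ht : t ≤ γ.length) (u : X → ℝ) (g : X → ℝ≥0∞) :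
    (γ.arc hs hst ht).UpperGradientIneq u g ↔
      ENNReal.ofReal |u (γ.arcLength s) - u (γ.arcLength t)| ≤
        ∫⁻ x in Icc s t, g (γ.arcLength x) := by
  rw [UpperGradientIneq, integral_arc]
  rfl

lemma upperGradientIneq_iff (γ : Curve X) (u : X → ℝ) (g : X → ℝ≥0∞) :
    γ.UpperGradientIneq u g ↔
      ENNReal.ofReal |u (γ.arcLength 0) - u (γ.arcLength γ.length)| ≤
        ∫⁻ x in Icc 0 γ.length, g (γ.arcLength x) := by
  rw [UpperGradientIneq, integral, arcLength_zero, arcLength_length]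

lemma integral_mono (γ : Curve X) {g h : X → ℝ≥0∞} (hgh : g ≤ h) :
    γ.integral g ≤ γ.integral h :=
  lintegral_mono fun _ => hgh _

lemma aemeasurable_comp_arcLength [MeasurableSpace X] [BorelSpace X] (γ : Curve X)
    {g : X → ℝ≥0∞} (hg : Measurable g) :
    AEMeasurable (fun t => g (γ.arcLength t)) (volume.restrict (Icc 0 γ.length)) :=
  hg.comp_aemeasurable (γ.lipschitzOnWith_arcLength.continuousOn.aemeasurable measurableSet_Icc)

end Curve

/-- Two functions have the same derivative at almost every point where they agree and are both
differentiable. -/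
lemma ae_deriv_eq_of_eq (V F : ℝ → ℝ) :
    ∀ᵐ x, V x = F x → DifferentiableAt ℝ V x → DifferentiableAt ℝ F x →
      deriv V x = deriv F x := by
  have hc := (countable_setOfPred_isolated_right_within (s := {x : ℝ | V x = F x})).ae_notMem
    volume
  filter_upwards [hc] with x hx hVF hV hF
  have hne : (𝓝[{x | V x = F x} ∩ Ioi x] x).NeBot := ⟨fun h => hx ⟨hVF, h⟩⟩
  have hle : 𝓝[{x | V x = F x} ∩ Ioi x] x ≤ 𝓝[≠] x :=
    nhdsWithin_mono _ fun y hy => ne_of_gt hy.2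
  have hfr : ∃ᶠ y in 𝓝[≠] x, (V - F) y = 0 := by
    refine Frequently.filter_mono (Eventually.frequently ?_) hle
    filter_upwards [self_mem_nhdsWithin] with y hy
    exact sub_eq_zero.2 hy.1
  have h0 := deriv_zero_of_frequently_const hfr
  rw [deriv_sub hV hF] at h0
  exact sub_eq_zero.1 h0

variable {a b : ℝ}

lemma ae_ofReal_abs_deriv_le {V : ℝ → ℝ} {G : ℝ → ℝ≥0∞} (hab : a ≤ b)
    (hV : AbsolutelyContinuousOnInterval V a b)
    (hG : AEMeasurable G (volume.restrict (Icc a b))) (hfin : ∫⁻ x in Icc a b, G x ≠ ∞)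
    (h : ∀ s t, a ≤ s → s < t → t ≤ b →
      ENNReal.ofReal |V s - V t| ≤ ∫⁻ x in Icc s t, G x) :
    ∀ᵐ x, x ∈ Icc a b → ENNReal.ofReal |deriv V x| ≤ G x := by
  have hint : IntegrableOn (fun x => (G x).toReal) (Icc a b) :=
    integrable_toReal_of_lintegral_ne_top hG hfin
  have hii : IntervalIntegrable (fun x => (G x).toReal) volume a b :=
    (intervalIntegrable_iff_integrableOn_Icc_of_le hab).2 hint
  have hdV := hV.ae_differentiableAt
  have hdH := hii.ae_hasDerivAt_integral
  rw [uIcc_of_le hab] at hdV hdH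
  have hb : ∀ᵐ x : ℝ, x ≠ b := by simp [ae_iff, measure_singleton]
  filter_upwards [hdV, hdH, hb] with x hVx hHx hxb hx
  have h1 := (hHx hx a (left_mem_Icc.2 hab)).tendsto_slope.mono_left
    (nhdsWithin_mono x fun y (hy : y ∈ Ioi x) => ne_of_gt hy)
  have h2 := ((hVx hx).hasDerivAt.tendsto_slope.mono_left
    (nhdsWithin_mono x fun y (hy : y ∈ Ioi x) => ne_of_gt hy)).abs
  have hxb' : x < b := lt_of_le_of_ne hx.2 hxb
  have hle : |deriv V x| ≤ (G x).toReal := by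
    refine le_of_tendsto_of_tendsto h2 h1 ?_
    filter_upwards [Ioo_mem_nhdsGT hxb'] with y hy
    have hsub : Icc x y ⊆ Icc a b := Icc_subset_Icc hx.1 hy.2.le
    have h3 := h x y hx.1 hy.1 hy.2.le
    have hfin' : ∫⁻ z in Icc x y, G z ≠ ∞ := ne_top_of_le_ne_top hfin (lintegral_mono_set hsub)
    have h4 : |V x - V y| ≤ ∫ z in x..y, (G z).toReal := by
      rw [intervalIntegral.integral_of_le hy.1.le, ← integral_Icc_eq_integral_Ioc,
        integral_toReal (hG.mono_measure (Measure.restrict_mono hsub le_rfl))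
          (ae_lt_top' (hG.mono_measure (Measure.restrict_mono hsub le_rfl)) hfin')]
      exact (ENNReal.ofReal_le_iff_le_toReal hfin').1 h3
    have h5 : (∫ z in a..y, (G z).toReal) - ∫ z in a..x, (G z).toReal =
        ∫ z in x..y, (G z).toReal := by
      rw [intervalIntegral.integral_interval_sub_left]
      · exact (intervalIntegrable_iff_integrableOn_Icc_of_le (hx.1.trans hy.1.le)).2
          (hint.mono_set (Icc_subset_Icc le_rfl hy.2.le))
      · exact (intervalIntegrable_iff_integrableOn_Icc_of_le hx.1).2
          (hint.mono_set (Icc_subset_Icc le_rfl hx.2))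
    rw [slope_def_field, slope_def_field, abs_div, h5, abs_of_pos (sub_pos.2 hy.1), abs_sub_comm]
    exact div_le_div_of_nonneg_right h4 (sub_pos.2 hy.1).le
  exact (ENNReal.ofReal_le_ofReal hle).trans ENNReal.ofReal_toReal_le

lemma ofReal_abs_sub_le_lintegral {V : ℝ → ℝ} {G : ℝ → ℝ≥0∞} (hab : a ≤ b)
    (hV : AbsolutelyContinuousOnInterval V a b)
    (h : ∀ᵐ x, x ∈ Icc a b → ENNReal.ofReal |deriv V x| ≤ G x) :
    ENNReal.ofReal |V a - V b| ≤ ∫⁻ x in Icc a b, G x := by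
  rw [abs_sub_comm, ← hV.integral_deriv_eq_sub, intervalIntegral.integral_of_le hab,
    ← integral_Icc_eq_integral_Ioc, ← Real.enorm_eq_ofReal_abs]
  refine (enorm_integral_le_lintegral_enorm _).trans (setLIntegral_mono_ae' measurableSet_Icc ?_)
  filter_upwards [h] with x hx hxab
  rw [Real.enorm_eq_ofReal_abs]
  exact hx hxab

open scoped Classical in
/-- One-dimensional gluing: if `V = F` on `E`, then on `E` an upper gradient of `V` may be replaced
by one of `F`. -/
lemma ofReal_abs_sub_le_lintegral_piecewise {V F : ℝ → ℝ} {G H : ℝ → ℝ≥0∞} {E : Set ℝ}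
    (hab : a ≤ b)
    (hV : AbsolutelyContinuousOnInterval V a b) (hF : AbsolutelyContinuousOnInterval F a b)
    (hG : AEMeasurable G (volume.restrict (Icc a b))) (hGfin : ∫⁻ x in Icc a b, G x ≠ ∞)
    (hH : AEMeasurable H (volume.restrict (Icc a b))) (hHfin : ∫⁻ x in Icc a b, H x ≠ ∞)
    (hVG : ∀ s t, a ≤ s → s < t → t ≤ b →
      ENNReal.ofReal |V s - V t| ≤ ∫⁻ x in Icc s t, G x)
    (hFH : ∀ s t, a ≤ s → s < t → t ≤ b →
      ENNReal.ofReal |F s - F t| ≤ ∫⁻ x in Icc s t, H x)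
    (hE : ∀ x ∈ E, V x = F x) :
    ENNReal.ofReal |V a - V b| ≤ ∫⁻ x in Icc a b, E.piecewise H G x := by
  refine ofReal_abs_sub_le_lintegral hab hV ?_
  have hdV := hV.ae_differentiableAt
  have hdF := hF.ae_differentiableAt
  rw [uIcc_of_le hab] at hdV hdF
  filter_upwards [ae_ofReal_abs_deriv_le hab hV hG hGfin hVG,
    ae_ofReal_abs_deriv_le hab hF hH hHfin hFH, ae_deriv_eq_of_eq V F, hdV, hdF]
    with x h1 h2 h3 h4 h5 hx
  by_cases hxE : x ∈ E
  · rw [piecewise_eq_of_mem _ _ _ hxE, h3 (hE x hxE) (h4 hx) (h5 hx)]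
    exact h2 hx
  · rw [piecewise_eq_of_notMem _ _ _ hxE]
    exact h1 hx

section

variable {α : Type*} [MeasurableSpace α] {μ : Measure α}

open scoped Classical in
lemma aemeasurable_piecewise {E : Set α} (hE : MeasurableSet E) {g h : α → ℝ≥0∞}
    (hg : AEMeasurable g μ) (hh : AEMeasurable h μ) : AEMeasurable (E.piecewise h g) μ := by
  refine ⟨E.piecewise (hh.mk h) (hg.mk g), hh.measurable_mk.piecewise hE hg.measurable_mk, ?_⟩
  filter_upwards [hg.ae_eq_mk, hh.ae_eq_mk] with x h1 h2
  by_cases hx : x ∈ E <;> simp [hx, h1, h2]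

open scoped Classical in
lemma lintegral_piecewise_add_lintegral_piecewise {E : Set α} (hE : MeasurableSet E)
    (g h : α → ℝ≥0∞) :
    ∫⁻ x, E.piecewise g h x ∂μ + ∫⁻ x, E.piecewise h g x ∂μ =
      ∫⁻ x, g x ∂μ + ∫⁻ x, h x ∂μ := by
  have hg := lintegral_add_compl (μ := μ) g hE
  have hh := lintegral_add_compl (μ := μ) h hE
  rw [lintegral_piecewise hE, lintegral_piecewise hE, ← hg, ← hh]
  ring

lemma liminf_add_liminf_le (a b : ℕ → ℝ≥0∞) :
    liminf a atTop + liminf b atTop ≤ liminf (fun i => a i + b i) atTop := by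
  simp only [liminf_eq_iSup_iInf_of_nat]
  rw [ENNReal.iSup_add_iSup_of_monotone]
  · exact iSup_mono fun n => le_iInf₂ fun i hi => add_le_add (iInf₂_le i hi) (iInf₂_le i hi)
  · exact fun m n hmn => le_iInf₂ fun i hi => iInf₂_le i (hmn.trans hi)
  · exact fun m n hmn => le_iInf₂ fun i hi => iInf₂_le i (hmn.trans hi)

end

section

variable {X : Type*} [MetricSpace X]

lemma exists_arcLength_mem_ball (γ : Curve X) (x₀ : X) :
    ∃ n : ℕ, ∀ t ∈ Icc 0 γ.length, γ.arcLength t ∈ Metric.ball x₀ n := by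
  have hb := (isCompact_Icc.image_of_continuousOn
    γ.lipschitzOnWith_arcLength.continuousOn).isBounded
  obtain ⟨r, hr⟩ := hb.subset_ball x₀
  obtain ⟨n, hn⟩ := exists_nat_ge r
  exact ⟨n, fun t ht => Metric.ball_subset_ball hn (hr (mem_image_of_mem _ ht))⟩

lemma absolutelyContinuousOnInterval_comp_arcLength {u : X → ℝ} (hu : LocallyLipschitz u)
    (γ : Curve X) : AbsolutelyContinuousOnInterval (fun t => u (γ.arcLength t)) 0 γ.length := by
  have hK := isCompact_Icc.image_of_continuousOn γ.lipschitzOnWith_arcLength.continuousOn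
  obtain ⟨K, hK⟩ := (hu.locallyLipschitzOn
    (s := γ.arcLength '' Icc 0 γ.length)).exists_lipschitzOnWith_of_compact hK
  have h := hK.comp γ.lipschitzOnWith_arcLength (mapsTo_image _ _)
  rw [← uIcc_of_le γ.length_nonneg] at h
  exact h.absolutelyContinuousOnInterval

lemma compactlyInside_ball [ProperSpace X] (x : X) (r : ℝ) :
    CompactlyInside (Metric.ball x r) univ :=
  ⟨Metric.isOpen_ball, Metric.isBounded_ball.isCompact_closure, subset_univ _⟩

lemma lipLoc_univ_iff [ProperSpace X] {u : X → ℝ} :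
    LipLoc univ u ↔ LocallyLipschitz u := by
  constructor
  · intro h x
    obtain ⟨K, hK⟩ := h _ (compactlyInside_ball x 1)
    exact ⟨K, _, Metric.ball_mem_nhds x one_pos, hK⟩
  · intro h Ω' hΩ'
    obtain ⟨K, hK⟩ := (h.locallyLipschitzOn (s := closure Ω')).exists_lipschitzOnWith_of_compact
      hΩ'.2.1
    exact ⟨K, hK.mono subset_closure⟩

end

variable {X : Type*} [MetricSpace X] [MeasurableSpace X] {μ : Measure X}

lemma ZeroModulus.mono {Γ Γ' : Set (Curve X)} (h : ZeroModulus μ Γ) (hsub : Γ' ⊆ Γ) :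
    ZeroModulus μ Γ' := by
  obtain ⟨ρ, h1, h2, h3⟩ := h
  exact ⟨ρ, h1, h2, fun γ hγ => h3 γ (hsub hγ)⟩

lemma ZeroModulus.union {Γ Γ' : Set (Curve X)} (h : ZeroModulus μ Γ) (h' : ZeroModulus μ Γ') :
    ZeroModulus μ (Γ ∪ Γ') := by
  obtain ⟨ρ, h1, h2, h3⟩ := h
  obtain ⟨ρ', h1', h2', h3'⟩ := h'
  refine ⟨ρ + ρ', h1.add h1', ?_, ?_⟩
  · simp only [Pi.add_apply]
    rw [lintegral_add_left h1]
    exact ENNReal.add_ne_top.2 ⟨h2, h2'⟩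
  · rintro γ (hγ | hγ)
    · exact top_le_iff.1 ((h3 γ hγ).symm.le.trans (γ.integral_mono le_self_add))
    · exact top_le_iff.1 ((h3' γ hγ).symm.le.trans (γ.integral_mono le_add_self))

/-- The curves having an arc in a family of zero modulus form a family of zero modulus. -/
lemma ZeroModulus.exists_arc {Γ : Set (Curve X)} (h : ZeroModulus μ Γ) :
    ZeroModulus μ {γ : Curve X | ∃ (s t : ℝ) (hs : 0 ≤ s) (hst : s < t) (ht : t ≤ γ.length),
      γ.arc hs hst ht ∈ Γ} := by
  obtain ⟨ρ, h1, h2, h3⟩ := h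
  refine ⟨ρ, h1, h2, ?_⟩
  rintro γ ⟨s, t, hs, hst, ht, hγ⟩
  exact top_le_iff.1 ((h3 _ hγ).symm.le.trans (γ.integral_arc_le hs hst ht ρ))

open scoped Classical in
lemma LocallyFinite.piecewise {E Ω : Set X} (hE : MeasurableSet E) {g h : X → ℝ≥0∞}
    (hg : LocallyFinite μ Ω g) (hh : LocallyFinite μ Ω h) :
    LocallyFinite μ Ω (E.piecewise h g) := by
  intro Ω' hΩ'
  rw [lintegral_piecewise hE]
  exact ENNReal.add_ne_top.2
    ⟨ne_top_of_le_ne_top (hh Ω' hΩ') (lintegral_mono' Measure.restrict_le_self le_rfl),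
      ne_top_of_le_ne_top (hg Ω' hΩ') (lintegral_mono' Measure.restrict_le_self le_rfl)⟩

lemma LocallyFinite.add {Ω : Set X} {g h : X → ℝ≥0∞} (hgm : AEMeasurable g μ)
    (hg : LocallyFinite μ Ω g) (hh : LocallyFinite μ Ω h) : LocallyFinite μ Ω (g + h) := by
  intro Ω' hΩ'
  simp only [Pi.add_apply]
  rw [lintegral_add_left' hgm.restrict]
  exact ENNReal.add_ne_top.2 ⟨hg Ω' hΩ', hh Ω' hΩ'⟩

/-- The sum of weak upper gradients of `u` and `v` is a weak upper gradient of every function whose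
increments are dominated by those of `u` and `v`. -/
lemma IsWeakUpperGradient.add {Ω : Set X} {u v f : X → ℝ} {g h : X → ℝ≥0∞}
    (hg : IsWeakUpperGradient μ Ω u g) (hh : IsWeakUpperGradient μ Ω v h)
    (hf : ∀ x y, |f x - f y| ≤ |u x - u y| + |v x - v y|) :
    IsWeakUpperGradient μ Ω f (g + h) := by
  refine ⟨hg.1.add hh.1, (hg.2.union hh.2).mono ?_⟩
  rintro γ ⟨hγΩ, hγ⟩
  by_contra hn
  rw [mem_union, not_or] at hn
  have h1 : γ.UpperGradientIneq u g := by
    by_contra hno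
    exact hn.1 ⟨hγΩ, hno⟩
  have h2 : γ.UpperGradientIneq v h := by
    by_contra hno
    exact hn.2 ⟨hγΩ, hno⟩
  refine hγ ((ENNReal.ofReal_le_ofReal (hf _ _)).trans ?_)
  rw [ENNReal.ofReal_add (abs_nonneg _) (abs_nonneg _)]
  exact (add_le_add h1 h2).trans (le_lintegral_add _ _)

variable [BorelSpace X]

/-- Almost every curve spends zero time in a given null set. -/
lemma zeroModulus_not_ae {g g' : X → ℝ≥0∞} (h : g =ᵐ[μ] g') :
    ZeroModulus μ {γ : Curve X | ¬ ∀ᵐ t ∂(volume.restrict (Icc 0 γ.length)),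
      g (γ.arcLength t) = g' (γ.arcLength t)} := by
  obtain ⟨N, hN, hNm, hN0⟩ := exists_measurable_superset_of_null (ae_iff.1 h)
  refine ⟨N.indicator fun _ => ∞, measurable_const.indicator hNm, ?_, ?_⟩
  · simp [lintegral_indicator_const hNm, hN0]
  · intro γ hγ
    by_contra hne
    refine hγ ?_
    have hm : Measurable (N.indicator fun _ : X => (∞ : ℝ≥0∞)) := measurable_const.indicator hNm
    filter_upwards [ae_lt_top' (γ.aemeasurable_comp_arcLength hm) hne] with t ht
    by_contra hne
    rw [indicator_of_mem (hN hne)] at ht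
    exact lt_irrefl _ ht

/-- A locally integrable function has finite integral on almost every curve. -/
lemma zeroModulus_integral_eq_top [ProperSpace X] {g : X → ℝ≥0∞} (hg : AEMeasurable g μ)
    (hfin : LocallyFinite μ univ g) : ZeroModulus μ {γ : Curve X | γ.integral g = ∞} := by
  rcases isEmpty_or_nonempty X with hX | ⟨⟨x₀⟩⟩
  · exact ⟨0, measurable_zero, by simp, fun γ _ => isEmptyElim (γ.toFun γ.a)⟩
  obtain ⟨δ, hδ, hsum⟩ := ENNReal.exists_pos_tsum_mul_lt_of_countable one_ne_zero
    (fun n : ℕ => ∫⁻ x in Metric.ball x₀ n, hg.mk g x ∂μ)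
    (fun n => by
      rw [← lintegral_congr_ae (ae_restrict_of_ae hg.ae_eq_mk)]
      exact hfin _ (compactlyInside_ball x₀ n))
  have hm : ∀ n : ℕ, Measurable ((Metric.ball x₀ n).indicator (hg.mk g)) := fun n =>
    hg.measurable_mk.indicator Metric.isOpen_ball.measurableSet
  have hZ : ZeroModulus μ {γ : Curve X | γ.integral (hg.mk g) = ∞} := by
    refine ⟨fun x => ∑' n : ℕ, (Metric.ball x₀ n).indicator (hg.mk g) x * δ n,
      Measurable.tsum fun n => (hm n).mul_const _, ?_, ?_⟩
    · rw [lintegral_tsum fun n => ((hm n).mul_const _).aemeasurable]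
      refine ne_top_of_le_ne_top ENNReal.one_ne_top (le_trans (le_of_eq ?_) hsum.le)
      congr 1 with n
      rw [lintegral_mul_const _ (hm n), lintegral_indicator Metric.isOpen_ball.measurableSet]
    · intro γ hγ
      obtain ⟨n, hn⟩ := exists_arcLength_mem_ball γ x₀
      have h1 : γ.integral (hg.mk g) * δ n ≤
          γ.integral (fun x => ∑' n : ℕ, (Metric.ball x₀ n).indicator (hg.mk g) x * δ n) := by
        rw [Curve.integral, ← lintegral_mul_const'' _ (γ.aemeasurable_comp_arcLength
          hg.measurable_mk)]
        refine setLIntegral_mono' measurableSet_Icc fun t ht => ?_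
        refine le_trans (le_of_eq ?_) (ENNReal.le_tsum n)
        rw [indicator_of_mem (hn t ht)]
      rw [hγ, ENNReal.top_mul (by exact_mod_cast (hδ n).ne')] at h1
      exact top_le_iff.1 h1
  refine (hZ.union (zeroModulus_not_ae hg.ae_eq_mk)).mono fun γ hγ => ?_
  by_contra hn
  rw [mem_union, not_or] at hn
  refine hn.1 ?_
  rw [mem_ofPred_eq, ← hγ]
  exact (lintegral_congr_ae (not_not.1 hn.2)).symm

/-- Almost every curve satisfies the upper gradient inequality on all of its arcs, with a finite
right-hand side. -/
lemma IsWeakUpperGradient.zeroModulus_arcs [ProperSpace X] {u : X → ℝ} {g : X → ℝ≥0∞}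
    (h : IsWeakUpperGradient μ univ u g) (hfin : LocallyFinite μ univ g) :
    ZeroModulus μ {γ : Curve X | ¬
      (AEMeasurable (fun t => g (γ.arcLength t)) (volume.restrict (Icc 0 γ.length)) ∧
      ∫⁻ t in Icc 0 γ.length, g (γ.arcLength t) ≠ ∞ ∧
      ∀ s t, 0 ≤ s → s < t → t ≤ γ.length →
        ENNReal.ofReal |u (γ.arcLength s) - u (γ.arcLength t)| ≤
          ∫⁻ x in Icc s t, g (γ.arcLength x))} := by
  have hg : AEMeasurable g μ := by simpa using h.1
  refine (((zeroModulus_not_ae hg.ae_eq_mk).union (zeroModulus_integral_eq_top hg hfin)).union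
    h.2.exists_arc).mono fun γ hγ => ?_
  by_contra hn
  rw [mem_union, mem_union, not_or, not_or] at hn
  obtain ⟨⟨h1, h2⟩, h3⟩ := hn
  refine hγ ⟨(γ.aemeasurable_comp_arcLength hg.measurable_mk).congr
    (EventuallyEq.symm (not_not.1 h1)), h2, fun s t hs hst ht => ?_⟩
  rw [← γ.upperGradientIneq_arc_iff hs hst ht]
  by_contra hno
  exact h3 ⟨s, t, hs, hst, ht, subset_univ _, hno⟩

open scoped Classical in
/-- Gluing of weak upper gradients: where two locally Lipschitz functions agree, their weak upper
gradients may be interchanged. -/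
lemma IsWeakUpperGradient.piecewise [ProperSpace X] {u v : X → ℝ} {g h : X → ℝ≥0∞} {E : Set X}
    (hu : LocallyLipschitz u) (hv : LocallyLipschitz v)
    (hg : IsWeakUpperGradient μ univ u g) (hgfin : LocallyFinite μ univ g)
    (hh : IsWeakUpperGradient μ univ v h) (hhfin : LocallyFinite μ univ h)
    (hE : MeasurableSet E) (huv : ∀ x ∈ E, u x = v x) :
    IsWeakUpperGradient μ univ u (E.piecewise h g) := by
  refine ⟨aemeasurable_piecewise hE hg.1 hh.1, ?_⟩
  refine ((hg.zeroModulus_arcs hgfin).union (hh.zeroModulus_arcs hhfin)).mono fun γ hγ => ?_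
  by_contra hn
  rw [mem_union, not_or] at hn
  obtain ⟨⟨g1, g2, g3⟩, h1, h2, h3⟩ := hn.imp not_not.1 not_not.1
  refine hγ.2 ?_
  rw [γ.upperGradientIneq_iff]
  refine (ofReal_abs_sub_le_lintegral_piecewise (E := γ.arcLength ⁻¹' E) γ.length_nonneg
    (absolutelyContinuousOnInterval_comp_arcLength hu γ)
    (absolutelyContinuousOnInterval_comp_arcLength hv γ) g1 g2 h1 h2 g3 h3
    fun x hx => huv _ hx).trans_eq ?_
  rfl

open scoped Classical in
/-- A function which coincides with `u` on `E` and with `v` off `E` has as minimal weak upper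
gradient the one of `u` on `E` and the one of `v` off `E`. -/
lemma IsMinimalWeakUpperGradient.piecewise [ProperSpace X] {u v f : X → ℝ} {g h : X → ℝ≥0∞}
    {E : Set X} (hu : LocallyLipschitz u) (hv : LocallyLipschitz v) (hf : LocallyLipschitz f)
    (hg : IsMinimalWeakUpperGradient μ univ u g) (hh : IsMinimalWeakUpperGradient μ univ v h)
    (hfuv : ∀ x y, |f x - f y| ≤ |u x - u y| + |v x - v y|)
    (hE : MeasurableSet E) (hfu : ∀ x ∈ E, f x = u x) (hfv : ∀ x ∈ Eᶜ, f x = v x) :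
    IsMinimalWeakUpperGradient μ univ f (E.piecewise g h) := by
  obtain ⟨hg1, hg2, hg3⟩ := hg
  obtain ⟨hh1, hh2, hh3⟩ := hh
  have hfin : LocallyFinite μ univ (E.piecewise g h) := hh2.piecewise hE hg2
  refine ⟨?_, hfin, fun k hk hkfin => ?_⟩
  · have hs := hg1.add hh1 hfuv
    have hsfin := hg2.add (by simpa using hg1.1) hh2
    have h1 := hs.piecewise hf hu hsfin hg1 hg2 hE hfu
    have h2 := h1.piecewise hf hv (hsfin.piecewise hE hg2) hh1 hh2 hE.compl hfv
    convert h2 using 1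
    ext x
    by_cases hx : x ∈ E <;> simp [hx]
  · have h1 := hg3 _ (hg1.piecewise hu hf hg2 hk hkfin hE fun x hx => (hfu x hx).symm)
      (hg2.piecewise hE hkfin)
    have h2 := hh3 _ (hh1.piecewise hv hf hh2 hk hkfin hE.compl fun x hx => (hfv x hx).symm)
      (hh2.piecewise hE.compl hkfin)
    filter_upwards [h1, h2] with x hx1 hx2
    by_cases hx : x ∈ E
    · simpa [hx] using hx1
    · simpa [hx] using hx2

section Doubling

variable {X : Type*} [MetricSpace X] [MeasurableSpace X] {μ : Measure X}

lemma IsDoubling.measure_ball_pos (h : IsDoubling μ) (x : X) {r : ℝ} (hr : 0 < r) :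
    0 < μ (Metric.ball x r) := by
  obtain ⟨C, -, hC⟩ := h
  simpa [mul_div_cancel₀] using (hC x (r / 2) (half_pos hr)).1

lemma IsDoubling.measure_ball_lt_top (h : IsDoubling μ) (x : X) {r : ℝ} (hr : 0 < r) :
    μ (Metric.ball x r) < ∞ := by
  obtain ⟨C, -, hC⟩ := h
  exact (hC x r hr).2.2

lemma IsDoubling.exists_measure_ball_le (h : IsDoubling μ) (n : ℕ) :
    ∃ C : ℝ≥0∞, C ≠ ∞ ∧ ∀ (x : X) (r : ℝ), 0 < r →
      μ (Metric.ball x (2 ^ n * r)) ≤ C * μ (Metric.ball x r) := by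
  obtain ⟨C, -, hC⟩ := h
  refine ⟨ENNReal.ofReal C ^ n, ENNReal.pow_ne_top ENNReal.ofReal_ne_top, fun x r hr => ?_⟩
  induction n with
  | zero => simp
  | succ n ih =>
    rw [pow_succ', pow_succ', mul_assoc, mul_assoc]
    exact (hC x (2 ^ n * r) (by positivity)).2.1.trans (mul_le_mul_right ih _)

lemma IsDoubling.totallyBounded_ball [BorelSpace X] (h : IsDoubling μ) (x : X) (R : ℝ) :
    TotallyBounded (Metric.ball x R) := by
  rw [Metric.totallyBounded_iff]
  intro ε hε
  by_contra! hno
  have hR : 0 < R := by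
    by_contra! hR
    exact hno ∅ finite_empty (by simp [Metric.ball_eq_empty.2 hR])
  obtain ⟨f, hf, hsep⟩ := exists_seq_of_forall_finset_exists (fun y => y ∈ Metric.ball x R)
    (fun y z => ε ≤ dist z y) fun s _ => by
      obtain ⟨z, hz, hz'⟩ := not_subset.1 (hno s s.finite_toSet)
      refine ⟨z, hz, fun y hy => ?_⟩
      by_contra! hlt
      exact hz' (mem_biUnion (Finset.mem_coe.2 hy) hlt)
  obtain ⟨n, hn⟩ := pow_unbounded_of_one_lt (2 * R / (ε / 2)) (one_lt_two (α := ℝ))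
  have hn' : 2 * R ≤ 2 ^ n * (ε / 2) := ((div_lt_iff₀ (half_pos hε)).1 hn).le
  obtain ⟨C, hCtop, hC⟩ := h.exists_measure_ball_le n
  have hpos : 0 < μ (Metric.ball x R) / C :=
    ENNReal.div_pos (h.measure_ball_pos x hR).ne' hCtop
  have hlow : ∀ i, μ (Metric.ball x R) / C ≤ μ (Metric.ball (f i) (ε / 2)) := by
    intro i
    refine ENNReal.div_le_of_le_mul' (le_trans (measure_mono ?_) (hC (f i) (ε / 2) (half_pos hε)))
    intro y hy
    have h1 := hf i
    rw [Metric.mem_ball] at h1 hy ⊢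
    linarith [dist_triangle_right y (f i) x]
  have hdisj : Pairwise (Function.onFun Disjoint fun i => Metric.ball (f i) (ε / 2)) := by
    intro i j hij
    refine Metric.ball_disjoint_ball ?_
    rw [add_halves]
    rcases hij.lt_or_gt with hlt | hlt
    · rw [dist_comm]
      exact hsep i j hlt
    · exact hsep j i hlt
  have hfin : μ (⋃ i, Metric.ball (f i) (ε / 2)) ≠ ∞ := by
    refine ne_top_of_le_ne_top (h.measure_ball_lt_top x (r := R + ε / 2) (by positivity)).ne
      (measure_mono (iUnion_subset fun i => Metric.ball_subset_ball' ?_))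
    have h1 := hf i
    rw [Metric.mem_ball] at h1
    linarith
  have := Measure.finite_const_le_meas_of_disjoint_iUnion μ hpos
    (fun i => Metric.isOpen_ball.measurableSet) hdisj hfin
  rw [eq_univ_of_forall (s := {i | _ ≤ _}) hlow] at this
  exact infinite_univ this

lemma IsDoubling.properSpace [CompleteSpace X] [BorelSpace X] (h : IsDoubling μ) :
    ProperSpace X := by
  refine ⟨fun x r => TotallyBounded.isCompact_of_isClosed ?_ Metric.isClosed_closedBall⟩
  exact (h.totallyBounded_ball x (r + 1)).subset (Metric.closedBall_subset_ball (by linarith))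

end Doubling

section TotalVariation

variable {X : Type*} [MetricSpace X] [MeasurableSpace X] {μ : Measure X}

lemma TendstoL1Loc.comp_tendsto {Ω : Set X} {v : ℕ → X → ℝ} {u : X → ℝ}
    (h : TendstoL1Loc μ Ω v u) {φ : ℕ → ℕ} (hφ : Tendsto φ atTop atTop) :
    TendstoL1Loc μ Ω (fun i => v (φ i)) u :=
  fun Ω' hΩ' => (h Ω' hΩ').comp hφ

lemma TendstoL1Loc.of_abs_sub_le {Ω : Set X} {v w f : ℕ → X → ℝ} {u₁ u₂ u : X → ℝ}
    (hv : TendstoL1Loc μ Ω v u₁) (hw : TendstoL1Loc μ Ω w u₂)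
    (hvm : ∀ i, AEMeasurable (v i) μ) (hum : AEMeasurable u₁ μ)
    (h : ∀ i x, |f i x - u x| ≤ |v i x - u₁ x| + |w i x - u₂ x|) : TendstoL1Loc μ Ω f u := by
  intro Ω' hΩ'
  have hsum := (hv Ω' hΩ').add (hw Ω' hΩ')
  rw [add_zero] at hsum
  refine tendsto_of_tendsto_of_tendsto_of_le_of_le tendsto_const_nhds hsum (fun _ => zero_le)
    fun i => ?_
  have hm : AEMeasurable (fun x => ENNReal.ofReal |v i x - u₁ x|) μ :=
    ((hvm i).sub hum).abs.ennreal_ofReal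
  dsimp only
  rw [← lintegral_add_left' hm.restrict]
  refine lintegral_mono fun x => ?_
  rw [← ENNReal.ofReal_add (abs_nonneg _) (abs_nonneg _)]
  exact ENNReal.ofReal_le_ofReal (h i x)

lemma totalVariation_zero : totalVariation μ univ (fun _ : X => (0 : ℝ)) = 0 := by
  refine le_antisymm (iInf_le_of_le (fun _ _ => 0) (iInf_le_of_le (fun _ _ => 0)
    (iInf_le_of_le ?_ (iInf_le_of_le ?_ (iInf_le_of_le ?_ ?_))))) (zero_le)
  · exact fun _ _ _ => ⟨0, (LipschitzWith.const 0).lipschitzOnWith⟩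
  · refine fun _ => ⟨⟨aemeasurable_const, 0, measurable_zero, by simp, ?_⟩, ?_, ?_⟩
    · rintro γ ⟨-, hγ⟩
      exact absurd (by simp [Curve.UpperGradientIneq]) hγ
    · intro Ω' _
      simp
    · exact fun h _ _ => Eventually.of_forall fun _ => zero_le
  · intro Ω' _
    simp
  · simp

lemma totalVariation_le_liminf {Ω : Set X} {u : X → ℝ} {v : ℕ → X → ℝ} {g : ℕ → X → ℝ≥0∞}
    (hv : ∀ i, LipLoc Ω (v i)) (hg : ∀ i, IsMinimalWeakUpperGradient μ Ω (v i) (g i))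
    (hvu : TendstoL1Loc μ Ω v u) :
    totalVariation μ Ω u ≤ liminf (fun i => ∫⁻ x in Ω, g i x ∂μ) atTop :=
  iInf_le_of_le v (iInf_le_of_le g (iInf_le_of_le hv (iInf_le_of_le hg (iInf_le _ hvu))))

lemma exists_of_totalVariation_lt {Ω : Set X} {u : X → ℝ} {a : ℝ≥0∞}
    (h : totalVariation μ Ω u < a) : ∃ (v : ℕ → X → ℝ) (g : ℕ → X → ℝ≥0∞),
      (∀ i, LipLoc Ω (v i)) ∧ (∀ i, IsMinimalWeakUpperGradient μ Ω (v i) (g i)) ∧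
      TendstoL1Loc μ Ω v u ∧ ∀ i, ∫⁻ x in Ω, g i x ∂μ < a := by
  simp only [totalVariation, iInf_lt_iff] at h
  obtain ⟨v, g, hv, hg, hvu, hlt⟩ := h
  obtain ⟨φ, hφ, hφa⟩ := extraction_of_frequently_atTop
    (frequently_lt_of_liminf_lt (by isBoundedDefault) hlt)
  exact ⟨fun i => v (φ i), fun i => g (φ i), fun i => hv _, fun i => hg _,
    hvu.comp_tendsto hφ.tendsto_atTop, hφa⟩

lemma totalVariation_min_add_totalVariation_max_le [ProperSpace X] [BorelSpace X]
    {u₁ u₂ : X → ℝ} (hu₁ : AEMeasurable u₁ μ) :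
    totalVariation μ univ (fun x => min (u₁ x) (u₂ x)) +
      totalVariation μ univ (fun x => max (u₁ x) (u₂ x)) ≤
    totalVariation μ univ u₁ + totalVariation μ univ u₂ := by
  classical
  refine le_of_forall_gt_imp_ge_of_dense fun c hc => ?_
  obtain ⟨a, ha, b, hb, hab⟩ := ENNReal.exists_add_lt_of_add_lt hc
  obtain ⟨v, g, hv, hg, hvu, hga⟩ := exists_of_totalVariation_lt ha
  obtain ⟨w, h, hw, hh, hwu, hhb⟩ := exists_of_totalVariation_lt hb
  simp only [lipLoc_univ_iff] at hv hw
  have hE : ∀ i, MeasurableSet {x | v i x ≤ w i x} := fun i =>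
    (isClosed_le (hv i).continuous (hw i).continuous).measurableSet
  have hvm : ∀ i, AEMeasurable (v i) μ := fun i => (hv i).continuous.aemeasurable
  have hminle : ∀ p q r s : ℝ, |min p q - min r s| ≤ |p - r| + |q - s| := fun p q r s =>
    (abs_min_sub_min_le_max _ _ _ _).trans (max_le_add_of_nonneg (abs_nonneg _) (abs_nonneg _))
  have hmaxle : ∀ p q r s : ℝ, |max p q - max r s| ≤ |p - r| + |q - s| := fun p q r s =>
    (abs_max_sub_max_le_max _ _ _ _).trans (max_le_add_of_nonneg (abs_nonneg _) (abs_nonneg _))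
  have hmin := totalVariation_le_liminf
    (fun i => lipLoc_univ_iff.2 ((hv i).min (hw i)))
    (fun i => (hg i).piecewise (hv i) (hw i) ((hv i).min (hw i)) (hh i)
      (fun x y => hminle _ _ _ _) (hE i) (fun x hx => min_eq_left hx)
      (fun x hx => min_eq_right (not_le.1 (show ¬ v i x ≤ w i x from hx)).le))
    (hvu.of_abs_sub_le hwu hvm hu₁ fun i x => hminle _ _ _ _)
  have hmax := totalVariation_le_liminf
    (fun i => lipLoc_univ_iff.2 ((hv i).max (hw i)))
    (fun i => (hh i).piecewise (hw i) (hv i) ((hv i).max (hw i)) (hg i)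
      (fun x y => (hmaxle _ _ _ _).trans_eq (add_comm _ _)) (hE i) (fun x hx => max_eq_right hx)
      (fun x hx => max_eq_left (not_le.1 (show ¬ v i x ≤ w i x from hx)).le))
    (hvu.of_abs_sub_le hwu hvm hu₁ fun i x => hmaxle _ _ _ _)
  refine (add_le_add hmin hmax).trans ((liminf_add_liminf_le _ _).trans ?_)
  refine liminf_le_of_le (by isBoundedDefault) fun d hd => ?_
  obtain ⟨i, hi⟩ := hd.exists
  rw [Measure.restrict_univ, lintegral_piecewise_add_lintegral_piecewise (hE i)] at hi
  have h1 := hga i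
  have h2 := hhb i
  rw [Measure.restrict_univ] at h1 h2
  exact hi.trans ((add_le_add h1.le h2.le).trans hab.le)

end TotalVariation

variable {X : Type*} [MetricSpace X] [MeasurableSpace X] {μ : Measure X}

section ApproximateLimits

/-- The set `A` has density zero at `x`. -/
def DensityZero (μ : Measure X) (A : Set X) (x : X) : Prop :=
  Tendsto (fun r : ℝ => μ (A ∩ Metric.ball x r) / μ (Metric.ball x r)) (𝓝[>] 0) (𝓝 0)

lemma DensityZero.mono {A B : Set X} {x : X} (hB : DensityZero μ B x) (hAB : A ⊆ B) :
    DensityZero μ A x :=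
  tendsto_of_tendsto_of_tendsto_of_le_of_le tendsto_const_nhds hB (fun _ => zero_le)
    fun _ => ENNReal.div_le_div_right (measure_mono (inter_subset_inter_left _ hAB)) _

lemma DensityZero.union {A B : Set X} {x : X} (hA : DensityZero μ A x) (hB : DensityZero μ B x) :
    DensityZero μ (A ∪ B) x := by
  have h := Tendsto.add hA hB
  rw [add_zero] at h
  refine tendsto_of_tendsto_of_tendsto_of_le_of_le tendsto_const_nhds h (fun _ => zero_le)
    fun r => ?_
  dsimp only
  rw [ENNReal.div_add_div_same, union_inter_distrib_right]
  exact ENNReal.div_le_div_right (measure_union_le _ _) _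

lemma densityZero_empty (x : X) : DensityZero μ ∅ x := by
  simp [DensityZero]

lemma IsDoubling.not_densityZero_univ (h : IsDoubling μ) (x : X) : ¬ DensityZero μ univ x := by
  intro hx
  have h1 : Tendsto (fun _ : ℝ => (1 : ℝ≥0∞)) (𝓝[>] (0 : ℝ)) (𝓝 0) := by
    refine hx.congr' ?_
    filter_upwards [self_mem_nhdsWithin] with r hr
    rw [univ_inter, ENNReal.div_self (h.measure_ball_pos x hr).ne'
      (h.measure_ball_lt_top x hr).ne]
  exact one_ne_zero (tendsto_nhds_unique tendsto_const_nhds h1)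

lemma le_approxLower {u : X → ℝ} {x : X} {t : ℝ} (h : DensityZero μ {y | u y < t} x) :
    (t : EReal) ≤ approxLower μ u x :=
  le_iSup₂_of_le t h le_rfl

lemma approxUpper_le {u : X → ℝ} {x : X} {t : ℝ} (h : DensityZero μ {y | t < u y} x) :
    approxUpper μ u x ≤ t :=
  iInf₂_le_of_le t h le_rfl

lemma exists_of_lt_approxLower {u : X → ℝ} {x : X} {c : EReal} (h : c < approxLower μ u x) :
    ∃ t : ℝ, DensityZero μ {y | u y < t} x ∧ c < t := by
  simp only [approxLower, lt_iSup_iff] at h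
  obtain ⟨t, ht, hc⟩ := h
  exact ⟨t, ht, hc⟩

lemma exists_of_approxUpper_lt {u : X → ℝ} {x : X} {c : EReal} (h : approxUpper μ u x < c) :
    ∃ t : ℝ, DensityZero μ {y | t < u y} x ∧ t < c := by
  simp only [approxUpper, iInf_lt_iff] at h
  obtain ⟨t, ht, hc⟩ := h
  exact ⟨t, ht, hc⟩

lemma approxLower_mono {u v : X → ℝ} (h : ∀ y, u y ≤ v y) (x : X) :
    approxLower μ u x ≤ approxLower μ v x :=
  iSup₂_le fun _ ht => le_approxLower (DensityZero.mono ht fun y hy => (h y).trans_lt hy)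

lemma approxUpper_mono {u v : X → ℝ} (h : ∀ y, u y ≤ v y) (x : X) :
    approxUpper μ u x ≤ approxUpper μ v x :=
  le_iInf₂ fun _ ht => approxUpper_le (DensityZero.mono ht fun y hy => lt_of_lt_of_le hy (h y))

lemma min_approxLower_le (u v : X → ℝ) (x : X) :
    min (approxLower μ u x) (approxLower μ v x) ≤ approxLower μ (fun y => min (u y) (v y)) x := by
  refine le_of_forall_lt fun c hc => ?_
  obtain ⟨s, hs, hcs⟩ := exists_of_lt_approxLower (lt_min_iff.1 hc).1
  obtain ⟨t, ht, hct⟩ := exists_of_lt_approxLower (lt_min_iff.1 hc).2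
  refine lt_of_lt_of_le ?_ (le_approxLower (t := min s t) ((hs.union ht).mono fun y hy => ?_))
  · rcases min_choice s t with h | h <;> rw [h] <;> assumption
  · rcases min_lt_iff.1 (show min (u y) (v y) < min s t from hy) with h | h
    · exact Or.inl (lt_of_lt_of_le h (min_le_left _ _))
    · exact Or.inr (lt_of_lt_of_le h (min_le_right _ _))

lemma approxUpper_max_le (u v : X → ℝ) (x : X) :
    approxUpper μ (fun y => max (u y) (v y)) x ≤ max (approxUpper μ u x) (approxUpper μ v x) := by
  refine le_of_forall_gt fun c hc => ?_
  obtain ⟨s, hs, hcs⟩ := exists_of_approxUpper_lt (max_lt_iff.1 hc).1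
  obtain ⟨t, ht, hct⟩ := exists_of_approxUpper_lt (max_lt_iff.1 hc).2
  refine lt_of_le_of_lt (approxUpper_le (t := max s t) ((hs.union ht).mono fun y hy => ?_)) ?_
  · rcases lt_max_iff.1 (show max s t < max (u y) (v y) from hy) with h | h
    · exact Or.inl (lt_of_le_of_lt (le_max_left _ _) h)
    · exact Or.inr (lt_of_le_of_lt (le_max_right _ _) h)
  · rcases max_choice s t with h | h <;> rw [h] <;> assumption

lemma IsDoubling.approxLower_le_approxUpper (h : IsDoubling μ) (u : X → ℝ) (x : X) :
    approxLower μ u x ≤ approxUpper μ u x := by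
  refine iSup₂_le fun t ht => le_iInf₂ fun s hs => ?_
  rw [EReal.coe_le_coe_iff]
  by_contra! hst
  refine h.not_densityZero_univ x (DensityZero.mono (DensityZero.union ht hs) fun y _ => ?_)
  rcases lt_or_ge (u y) t with h1 | h1
  · exact Or.inl h1
  · exact Or.inr (hst.trans_le h1)

lemma IsDoubling.approxLimits_zero (h : IsDoubling μ) (x : X) :
    approxLower μ (fun _ => 0) x = 0 ∧ approxUpper μ (fun _ => 0) x = 0 := by
  have h1 : ((0 : ℝ) : EReal) ≤ approxLower μ (fun _ => (0 : ℝ)) x :=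
    le_approxLower (by simpa using densityZero_empty x)
  have h2 : approxUpper μ (fun _ => (0 : ℝ)) x ≤ ((0 : ℝ) : EReal) :=
    approxUpper_le (by simpa using densityZero_empty x)
  rw [EReal.coe_zero] at h1 h2
  have h3 := h.approxLower_le_approxUpper (fun _ => (0 : ℝ)) x
  exact ⟨le_antisymm (h3.trans h2) h1, le_antisymm h2 (h1.trans h3)⟩

lemma IsDoubling.approxLimits_min (h : IsDoubling μ) {u v : X → ℝ} {x : X}
    (hu : approxLower μ u x = 0 ∧ approxUpper μ u x = 0)
    (hv : approxLower μ v x = 0 ∧ approxUpper μ v x = 0) :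
    approxLower μ (fun y => min (u y) (v y)) x = 0 ∧
      approxUpper μ (fun y => min (u y) (v y)) x = 0 := by
  have h1 := min_approxLower_le (μ := μ) u v x
  rw [hu.1, hv.1, min_self] at h1
  have h2 := approxUpper_mono (μ := μ) (fun y => min_le_left (u y) (v y)) x
  rw [hu.2] at h2
  have h3 := h.approxLower_le_approxUpper (fun y => min (u y) (v y)) x
  exact ⟨le_antisymm (h3.trans h2) h1, le_antisymm h2 (h1.trans h3)⟩

lemma IsDoubling.approxLimits_max (h : IsDoubling μ) {u v : X → ℝ} {x : X}
    (hu : approxLower μ u x = 0 ∧ approxUpper μ u x = 0)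
    (hv : approxLower μ v x = 0 ∧ approxUpper μ v x = 0) :
    approxLower μ (fun y => max (u y) (v y)) x = 0 ∧
      approxUpper μ (fun y => max (u y) (v y)) x = 0 := by
  have h1 := approxLower_mono (μ := μ) (fun y => le_max_left (u y) (v y)) x
  rw [hu.1] at h1
  have h2 := approxUpper_max_le (μ := μ) u v x
  rw [hu.2, hv.2, max_self] at h2
  have h3 := h.approxLower_le_approxUpper (fun y => max (u y) (v y)) x
  exact ⟨le_antisymm (h3.trans h2) h1, le_antisymm h2 (h1.trans h3)⟩

end ApproximateLimits

section Hausdorff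

lemma hausdorffContent_mono {R : ℝ} {A B : Set X} (hAB : A ⊆ B) :
    hausdorffContent μ R A ≤ hausdorffContent μ R B :=
  le_iInf fun S => le_iInf fun h1 => le_iInf fun h2 => le_iInf fun h3 =>
    iInf_le_of_le S (iInf_le_of_le h1 (iInf_le_of_le h2 (iInf_le _ (hAB.trans h3))))

lemma hausdorffContent_union_le (R : ℝ) (A B : Set X) :
    hausdorffContent μ R (A ∪ B) ≤ hausdorffContent μ R A + hausdorffContent μ R B := by
  conv_rhs => rw [hausdorffContent, hausdorffContent]
  simp only [ENNReal.iInf_add, ENNReal.add_iInf]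
  refine le_iInf fun T => le_iInf fun hT1 => le_iInf fun hT2 => le_iInf fun hT3 =>
    le_iInf fun S => le_iInf fun hS1 => le_iInf fun hS2 => le_iInf fun hS3 => ?_
  refine iInf_le_of_le (S ∪ T) (iInf_le_of_le (hS1.union hT1) (iInf_le_of_le ?_
    (iInf_le_of_le ?_ ?_)))
  · rintro p (hp | hp)
    · exact hS2 p hp
    · exact hT2 p hp
  · rw [biUnion_union]
    exact union_subset_union hS3 hT3
  · exact ENNReal.tsum_union_le
      (fun p : X × ℝ => μ (Metric.ball p.1 p.2) / ENNReal.ofReal p.2) S T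

lemma codimOneHausdorff_empty : codimOneHausdorff μ (∅ : Set X) = 0 := by
  refine le_antisymm (iSup₂_le fun R _ => ?_) zero_le
  refine iInf_le_of_le ∅ (iInf_le_of_le countable_empty (iInf_le_of_le (by simp)
    (iInf_le_of_le (empty_subset _) ?_)))
  simp

lemma codimOneHausdorff_null_mono {A B : Set X} (hB : codimOneHausdorff μ B = 0) (hAB : A ⊆ B) :
    codimOneHausdorff μ A = 0 :=
  le_antisymm ((iSup₂_mono fun _ _ => hausdorffContent_mono hAB).trans hB.le) zero_le

lemma codimOneHausdorff_null_union {A B : Set X} (hA : codimOneHausdorff μ A = 0)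
    (hB : codimOneHausdorff μ B = 0) : codimOneHausdorff μ (A ∪ B) = 0 := by
  refine le_antisymm (iSup₂_le fun R hR => (hausdorffContent_union_le R A B).trans ?_) zero_le
  have h1 : hausdorffContent μ R A ≤ 0 := hA ▸ le_iSup₂_of_le R hR le_rfl
  have h2 : hausdorffContent μ R B ≤ 0 := hB ▸ le_iSup₂_of_le R hR le_rfl
  simpa using add_le_add h1 h2

end Hausdorff

section Capacity

lemma rcapBV_le {A D : Set X} {u : X → ℝ} (hu : MemBVZero μ D u)
    (hA : codimOneHausdorff μ {x | x ∈ A ∧ ¬ 1 ≤ approxLower μ u x} = 0) :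
    rcapBV μ A D ≤ totalVariation μ univ u :=
  iInf_le_of_le u (iInf_le_of_le hu (iInf_le _ hA))

lemma MemBVZero.mono {D₁ D₂ : Set X} {u : X → ℝ} (hu : MemBVZero μ D₁ u) (hD : D₁ ⊆ D₂) :
    MemBVZero μ D₂ u :=
  ⟨hu.1, codimOneHausdorff_null_mono hu.2 fun _ hx => ⟨fun h => hx.1 (hD h), hx.2⟩⟩

lemma IsDoubling.memBVZero_zero (h : IsDoubling μ) (D : Set X) :
    MemBVZero μ D (fun _ => 0) := by
  refine ⟨⟨integrable_zero _ _ _, by simp [totalVariation_zero]⟩, ?_⟩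
  refine codimOneHausdorff_null_mono codimOneHausdorff_empty fun x hx => ?_
  exact hx.2 (h.approxLimits_zero x)

lemma IsDoubling.memBVZero_min_max [CompleteSpace X] [BorelSpace X] (h : IsDoubling μ)
    {D : Set X} {u v : X → ℝ} (hu : MemBVZero μ D u) (hv : MemBVZero μ D v) :
    MemBVZero μ D (fun x => min (u x) (v x)) ∧ MemBVZero μ D (fun x => max (u x) (v x)) := by
  have := h.properSpace
  have hTV := (totalVariation_min_add_totalVariation_max_le (u₂ := v) hu.1.1.aemeasurable).trans_lt
    (ENNReal.add_lt_top.2 ⟨hu.1.2, hv.1.2⟩)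
  refine ⟨⟨⟨hu.1.1.inf hv.1.1, (ENNReal.add_lt_top.1 hTV).1⟩, ?_⟩,
    ⟨⟨hu.1.1.sup hv.1.1, (ENNReal.add_lt_top.1 hTV).2⟩, ?_⟩⟩
  · refine codimOneHausdorff_null_mono (codimOneHausdorff_null_union hu.2 hv.2) fun x hx => ?_
    by_contra hn
    exact hx.2 (h.approxLimits_min (by_contra fun hk => hn (Or.inl ⟨hx.1, hk⟩))
      (by_contra fun hk => hn (Or.inr ⟨hx.1, hk⟩)))
  · refine codimOneHausdorff_null_mono (codimOneHausdorff_null_union hu.2 hv.2) fun x hx => ?_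
    by_contra hn
    exact hx.2 (h.approxLimits_max (by_contra fun hk => hn (Or.inl ⟨hx.1, hk⟩))
      (by_contra fun hk => hn (Or.inr ⟨hx.1, hk⟩)))

lemma IsDoubling.rcapBV_empty (h : IsDoubling μ) (D : Set X) : rcapBV μ ∅ D = 0 := by
  refine le_antisymm ((rcapBV_le (h.memBVZero_zero D) ?_).trans totalVariation_zero.le) zero_le
  simpa using codimOneHausdorff_empty

lemma rcapBV_mono_left {A₁ A₂ D : Set X} (hA : A₁ ⊆ A₂) : rcapBV μ A₁ D ≤ rcapBV μ A₂ D :=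
  le_iInf fun _ => le_iInf fun hu => le_iInf fun h => rcapBV_le hu
    (codimOneHausdorff_null_mono h fun _ hx => ⟨hA hx.1, hx.2⟩)

lemma rcapBV_anti_right {A D₁ D₂ : Set X} (hD : D₁ ⊆ D₂) : rcapBV μ A D₂ ≤ rcapBV μ A D₁ :=
  le_iInf fun _ => le_iInf fun hu => le_iInf fun h => rcapBV_le (hu.mono hD) h

lemma IsDoubling.rcapBV_inter_add_rcapBV_union_le [CompleteSpace X] [BorelSpace X]
    (h : IsDoubling μ) (A₁ A₂ D : Set X) :
    rcapBV μ (A₁ ∩ A₂) D + rcapBV μ (A₁ ∪ A₂) D ≤ rcapBV μ A₁ D + rcapBV μ A₂ D := by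
  have := h.properSpace
  conv_rhs => rw [rcapBV, rcapBV]
  simp only [ENNReal.iInf_add, ENNReal.add_iInf]
  refine le_iInf fun v => le_iInf fun hv => le_iInf fun hv1 => le_iInf fun u => le_iInf fun hu =>
    le_iInf fun hu1 => ?_
  obtain ⟨hmin, hmax⟩ := h.memBVZero_min_max hu hv
  refine (add_le_add (rcapBV_le hmin ?_) (rcapBV_le hmax ?_)).trans
    (totalVariation_min_add_totalVariation_max_le hu.1.1.aemeasurable)
  · refine codimOneHausdorff_null_mono (codimOneHausdorff_null_union hu1 hv1) fun x hx => ?_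
    by_contra hn
    simp only [mem_union, mem_ofPred_eq, not_or, not_and, not_not] at hn
    exact hx.2 ((le_min (hn.1 hx.1.1) (hn.2 hx.1.2)).trans (min_approxLower_le u v x))
  · refine codimOneHausdorff_null_mono (codimOneHausdorff_null_union hu1 hv1) fun x hx => ?_
    by_contra hn
    simp only [mem_union, mem_ofPred_eq, not_or, not_and, not_not] at hn
    rcases hx.1 with hx1 | hx2
    · exact hx.2 ((hn.1 hx1).trans (approxLower_mono (fun y => le_max_left _ _) x))
    · exact hx.2 ((hn.2 hx2).trans (approxLower_mono (fun y => le_max_right _ _) x))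

end Capacity

end MetricBV

theorem mainTheorem12 {X : Type*} [MetricSpace X] [CompleteSpace X] [MeasurableSpace X]
    [BorelSpace X] (μ : Measure X) (hμ : MetricBV.IsDoubling μ)
    (hP : MetricBV.SupportsPoincare μ) :
    (∀ D : Set X, MetricBV.rcapBV μ ∅ D = 0) ∧
    (∀ A₁ A₂ D : Set X, A₁ ⊆ A₂ → A₂ ⊆ D →
      MetricBV.rcapBV μ A₁ D ≤ MetricBV.rcapBV μ A₂ D) ∧
    (∀ A D₁ D₂ : Set X, A ⊆ D₁ → D₁ ⊆ D₂ →
      MetricBV.rcapBV μ A D₂ ≤ MetricBV.rcapBV μ A D₁) ∧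
    (∀ A₁ A₂ D : Set X, A₁ ⊆ D → A₂ ⊆ D →
      MetricBV.rcapBV μ (A₁ ∩ A₂) D + MetricBV.rcapBV μ (A₁ ∪ A₂) D ≤
        MetricBV.rcapBV μ A₁ D + MetricBV.rcapBV μ A₂ D) := by
  exact ⟨hμ.rcapBV_empty, fun _ _ _ hA _ => MetricBV.rcapBV_mono_left hA,
    fun _ _ _ _ hD => MetricBV.rcapBV_anti_right hD,
    fun A₁ A₂ D _ _ => hμ.rcapBV_inter_add_rcapBV_union_le A₁ A₂ D⟩
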